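/- Let $G$ be an infinite compact (Hausdorff) abelian group with normalized Haar measure $m$ (the regular, translation-invariant Borel probability measure), and let $\Gamma$ be its dual group, i.e. the group of all continuous homomorphisms from $G$ into the circle group. For $f \in L^1(G) = L^1(G,m;\mathbb{C})$ and for a regular complex Borel measure $\mu$ on $G$ put $\hat f(\gamma) = \int_G f\,\overline{\gamma}\,dm$ and $\hat\mu(\gamma) = \int_G \overline{\gamma}\,d\mu$ ($\gamma \in \Gamma$). For $\Theta \subset \Gamma$ let $$L^1_\Theta(G) = \{ f \in L^1(G) : \hat f(\gamma) = 0 \text{ for all } \gamma \in \Gamma\setminus\Theta \},$$ a closed subspace of $L^1(G)$, and let $M_\Theta(G)$ be the set of all regular complex Borel measures $\mu$ on $G$ with $\hat\mu(\gamma) = 0$ for all $\gamma\in\Gamma\setminus\Theta$. A bounded linear operator $T : X \to E$ between Banach spaces is called narrow if for all $x, y \in X$ with $\|x\| = \|y\| = 1$, every $x^* \in X^*$ and every $\varepsilon > 0$ there is $z \in X$ with $\|z\| = 1$, $\|T(y-z)\| + |x^*(y-z)| \le \varepsilon$ and $\|x+z\| \ge 2 - \varepsilon$. A closed subspace $Y$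 of $X$ is called rich if the quotient map $X \to X/Y$ is narrow. A set $\Lambda \subset \Gamma$ is called a semi-Riesz set if every $\mu \in M_\Lambda(G)$ is diffuse, i.e. satisfies $\mu(B) = 0$ for all countable $B \subset G$. Theorem. Let $\Lambda \subset \Gamma$ and $\Lambda^{-1} = \{\gamma^{-1} : \gamma \in \Lambda\}$. If $L^1_{\Gamma\setminus\Lambda^{-1}}(G)$ is a rich subspace of $L^1(G)$, then $\Lambda$ is a semi-Riesz set. -/

import Mathlib

open MeasureTheory
open scoped Pointwise ComplexConjugate

noncomputable section

/-! ### Narrow operators and rich subspaces -/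

/-- A bounded operator `T : X → E` is *narrow* if for all `x, y` in the unit sphere of `X`, every
functional `φ` on `X` and every `ε > 0` there is `z` in the unit sphere of `X` such that
`‖T (y - z)‖ + |φ (y - z)| ≤ ε` and `‖x + z‖ ≥ 2 - ε`. (The notion is used for spaces `X` with the
Daugavet property; that property follows from the existence of a narrow operator on `X`.) -/
def IsNarrow {𝕜 X E : Type*} [RCLike 𝕜] [NormedAddCommGroup X] [NormedSpace 𝕜 X]
    [NormedAddCommGroup E] [NormedSpace 𝕜 E] (T : X →L[𝕜] E) : Prop :=
  ∀ x y : X, ‖x‖ = 1 → ‖y‖ = 1 → ∀ φ : X →L[𝕜] 𝕜, ∀ ε : ℝ, 0 < ε →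
    ∃ z : X, ‖z‖ = 1 ∧ ‖T (y - z)‖ + ‖φ (y - z)‖ ≤ ε ∧ 2 - ε ≤ ‖x + z‖

/-- A closed subspace `Y` of `X` is *rich* if the quotient map `X → X ⧸ Y` is narrow. -/
def IsRich {𝕜 X : Type*} [RCLike 𝕜] [NormedAddCommGroup X] [NormedSpace 𝕜 X]
    (Y : ClosedSubmodule 𝕜 X) : Prop :=
  haveI : IsClosed (Y.toSubmodule : Set X) := Y.isClosed
  IsNarrow (𝕜 := 𝕜) Y.toSubmodule.mkQL

/-! ### Spectra of integrable functions and of measures -/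

variable {G : Type*} [CommGroup G] [TopologicalSpace G] [MeasurableSpace G]

/-- The Fourier transform `∫ conj γ * f dm` of `f ∈ L¹(G)` at the character `γ`. -/
def fourierL1 {m : Measure G} (f : Lp ℂ 1 m) (γ : PontryaginDual G) : ℂ :=
  ∫ x, conj (γ x : ℂ) * f x ∂m

/-- The spectrum of `f ∈ L¹(G)`: the characters at which its Fourier transform is not zero. -/
def specL1 {m : Measure G} (f : Lp ℂ 1 m) : Set (PontryaginDual G) :=
  {γ | fourierL1 f γ ≠ 0}

theorem integrable_conj_char_mul [BorelSpace G] {m : Measure G} (f : Lp ℂ 1 m)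
    (γ : PontryaginDual G) : Integrable (fun x => conj (γ x : ℂ) * f x) m := by
  refine (L1.integrable_coeFn f).bdd_mul (c := 1) ?_ ?_
  · have : Continuous fun x => conj (γ x : ℂ) := by
      have := map_continuous γ
      fun_prop
    exact this.measurable.aestronglyMeasurable
  · exact Filter.Eventually.of_forall fun x => by
      rw [RCLike.norm_conj, Circle.norm_coe (γ x)]

theorem fourierL1_add [BorelSpace G] {m : Measure G} (f g : Lp ℂ 1 m) (γ : PontryaginDual G) :
    fourierL1 (f + g) γ = fourierL1 f γ + fourierL1 g γ := by
  unfold fourierL1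
  rw [← integral_add (integrable_conj_char_mul f γ) (integrable_conj_char_mul g γ)]
  refine integral_congr_ae ?_
  filter_upwards [Lp.coeFn_add f g] with x hx
  rw [hx, Pi.add_apply, mul_add]

theorem fourierL1_smul [BorelSpace G] {m : Measure G} (c : ℂ) (f : Lp ℂ 1 m)
    (γ : PontryaginDual G) : fourierL1 (c • f) γ = c * fourierL1 f γ := by
  unfold fourierL1
  rw [← integral_const_mul]
  refine integral_congr_ae ?_
  filter_upwards [Lp.coeFn_smul c f] with x hx
  rw [hx, Pi.smul_apply, smul_eq_mul, mul_left_comm]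

/-- The Fourier transform at `γ` as a bounded linear functional on `L¹(G)`. -/
def fourierL1CLM [BorelSpace G] (m : Measure G) (γ : PontryaginDual G) : Lp ℂ 1 m →L[ℂ] ℂ :=
  LinearMap.mkContinuous
    { toFun := fun f => fourierL1 f γ
      map_add' := fun f g => fourierL1_add f g γ
      map_smul' := fun c f => fourierL1_smul c f γ } 1 (fun f => by
        change ‖∫ x, conj (γ x : ℂ) * f x ∂m‖ ≤ 1 * ‖f‖
        rw [one_mul, L1.norm_eq_integral_norm]
        refine (norm_integral_le_integral_norm _).trans_eq ?_
        refine integral_congr_ae (Filter.Eventually.of_forall fun x => ?_)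
        change ‖conj (γ x : ℂ) * f x‖ = ‖f x‖
        rw [norm_mul, RCLike.norm_conj, Circle.norm_coe (γ x), one_mul])

/-- `L¹_Λ(G)`, the closed subspace of all `f ∈ L¹(G)` with spectrum contained in `Λ`. -/
def L1Spec [BorelSpace G] (m : Measure G) (Λ : Set (PontryaginDual G)) :
    ClosedSubmodule ℂ (Lp ℂ 1 m) where
  carrier := {f | specL1 f ⊆ Λ}
  zero_mem' := fun γ hγ => absurd (map_zero (fourierL1CLM m γ)) hγ
  add_mem' := fun {f g} hf hg γ hγ => by
    by_contra h
    have h1 : fourierL1 f γ = 0 := by_contra fun h' => h (hf h')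
    have h2 : fourierL1 g γ = 0 := by_contra fun h' => h (hg h')
    exact hγ (by rw [fourierL1_add, h1, h2, add_zero])
  smul_mem' := fun c f hf γ hγ => by
    by_contra h
    have h1 : fourierL1 f γ = 0 := by_contra fun h' => h (hf h')
    exact hγ (by rw [fourierL1_smul, h1, mul_zero])
  isClosed' := by
    have : {f : Lp ℂ 1 m | specL1 f ⊆ Λ} = ⋂ γ ∈ Λᶜ, {f | fourierL1CLM m γ f = 0} := by
      ext f
      simp only [Set.mem_ofPred_eq, Set.mem_iInter]
      exact ⟨fun h γ hγ => by_contra fun h' => hγ (h h'),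
        fun h γ hγ => by_contra fun h' => hγ (h γ h')⟩
    change IsClosed {f : Lp ℂ 1 m | specL1 f ⊆ Λ}
    rw [this]
    exact isClosed_biInter fun γ _ =>
      isClosed_eq (fourierL1CLM m γ).continuous continuous_const

/-- The Fourier-Stieltjes transform `∫ conj γ dμ` of a complex measure `μ` at the
character `γ`. -/
def fourierStieltjes (μ : ComplexMeasure G) (γ : PontryaginDual G) : ℂ :=
  VectorMeasure.integral μ (fun x => conj (γ x : ℂ)) (ContinuousLinearMap.mul ℝ ℂ)

/-- The spectrum of a complex measure: the characters at which its Fourier-Stieltjes transform is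
not zero. -/
def specMeasure (μ : ComplexMeasure G) : Set (PontryaginDual G) :=
  {γ | fourierStieltjes μ γ ≠ 0}

/-- `M_Λ(G)`, the set of all regular complex Borel measures (complex measures with regular total
variation) with spectrum contained in `Λ`. -/
def measuresWithSpec (Λ : Set (PontryaginDual G)) : Set (ComplexMeasure G) :=
  {μ | μ.variation.Regular ∧ specMeasure μ ⊆ Λ}

/-- A complex measure is *diffuse* if all countable sets have measure zero. -/
def IsDiffuse (μ : ComplexMeasure G) : Prop :=
  ∀ B : Set G, B.Countable → μ B = 0

/-- `Λ` is a *semi-Riesz set* if every measure in `M_Λ(G)` is diffuse. -/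
def IsSemiRiesz (Λ : Set (PontryaginDual G)) : Prop :=
  ∀ μ ∈ measuresWithSpec Λ, IsDiffuse μ

end

/-! Let `μ ∈ M_Λ(G)` and let `f ∈ L¹(G)` have spectrum in `Γ \ Λ⁻¹`. The `L¹(G)`-valued integral
`∫ f (y * ·) dμ(y)` of the translates of `f` has the Fourier transform `γ ↦ f̂(γ) μ̂(γ⁻¹) = 0`,
hence it vanishes. If `L¹_{Γ \ Λ⁻¹}(G)` is rich, `f` can be chosen of norm one and almost
supported in an arbitrarily small neighbourhood `K` of `1`. An atom of `μ` at `b` then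
contributes a function of norm `|μ{b}|` that is almost supported in `b⁻¹ K`, while the translates
by points `y` away from `b` almost vanish there. So for each neighbourhood `W` of `b` the atom
must be cancelled by the part of `μ` in `W \ {b}`, which has arbitrarily small variation by
regularity.

A function `f ∈ L¹(G)` whose Fourier transform vanishes is zero because convolution with `f` is a
normal operator on `L²(G)`, which generates with the translations a commutative C⋆-algebra: if
the operator is not zero, some Gelfand character does not annihilate it, and restricted to the
translations this character is a `γ ∈ Γ` that detects `f`. -/

/-! ### Characters from commutative C⋆-algebras -/

theorem exists_characterSpace_apply_ne_zero {A : Type*} [CommCStarAlgebra A] {a : A}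
    (ha : a ≠ 0) : ∃ χ : WeakDual.characterSpace ℂ A, χ a ≠ 0 := by
  by_contra! h
  refine ha ((gelfandTransform_isometry A).injective ?_)
  ext χ
  exact (h χ).trans (by simp only [map_zero, ContinuousMap.zero_apply])

theorem exists_pontryaginDual_coe_eq {G A : Type*} [Group G] [TopologicalSpace G]
    [CommCStarAlgebra A] (v : G →* A) (hstar : ∀ x, star (v x) = v x⁻¹) {t : A}
    (hcont : Continuous fun x => v x * t) (χ : WeakDual.characterSpace ℂ A) (hχ : χ t ≠ 0) :
    ∃ γ : PontryaginDual G, ∀ x, (γ x : ℂ) = χ (v x) := by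
  have hunit (x : G) : ‖χ (v x)‖ = 1 := by
    have h : conj (χ (v x)) * χ (v x) = 1 := by
      calc conj (χ (v x)) * χ (v x) = χ (v (x⁻¹ * x)) := by
            rw [map_mul, map_mul, ← hstar, map_star, starRingEnd_apply]
        _ = 1 := by rw [inv_mul_cancel, map_one, map_one]
    rw [Complex.conj_mul'] at h
    exact (pow_eq_one_iff_of_nonneg (norm_nonneg _) two_ne_zero).1 (by exact_mod_cast h)
  have hχcont : Continuous fun x => χ (v x) := by
    refine (((map_continuous χ).comp hcont).div_const (χ t)).congr fun x => ?_
    rw [Function.comp_apply, map_mul, mul_div_cancel_right₀ _ hχ]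
  let γ : G →ₜ* Circle :=
    { toFun x := ⟨χ (v x), mem_sphere_zero_iff_norm.2 (hunit x)⟩
      map_one' := Circle.ext (by simp only [map_one, Circle.coe_one])
      map_mul' x y := Circle.ext ((congrArg χ (map_mul v x y)).trans (map_mul χ _ _))
      continuous_toFun := hχcont.subtype_mk _ }
  exact ⟨γ, fun x => rfl⟩

/-- The element `t` plays the role of `∫ f x • v x ∂μ`, an integral that need not exist in norm. -/
theorem exists_integral_mul_char_ne_zero_of_commute {G A : Type*} [Group G] [TopologicalSpace G]
    [MeasurableSpace G] {μ : Measure G} [CommCStarAlgebra A] (v : G →* A)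
    (hstar : ∀ x, star (v x) = v x⁻¹) {t : A} (ht : t ≠ 0) (hcont : Continuous fun x => v x * t)
    {f : G → ℂ} (hf : t * t = ∫ x, f x • (v x * t) ∂μ) :
    ∃ γ : PontryaginDual G, ∫ x, f x * γ x ∂μ ≠ 0 := by
  obtain ⟨χ, hχ⟩ := exists_characterSpace_apply_ne_zero ht
  obtain ⟨γ, hγ⟩ := exists_pontryaginDual_coe_eq v hstar hcont χ hχ
  have hχt : χ (t * t) ≠ 0 := by
    rw [map_mul]
    exact mul_ne_zero hχ hχ
  have hintegrable : Integrable (fun x => f x • (v x * t)) μ := by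
    refine .of_integral_ne_zero fun h => hχt ?_
    rw [hf, h, map_zero]
  have hχ_mul_self : χ (t * t) = (∫ x, f x * γ x ∂μ) * χ t := by
    calc χ (t * t) = ∫ x, χ (f x • (v x * t)) ∂μ := by
          rw [hf]
          exact ((WeakDual.CharacterSpace.toCLM χ).integral_comp_comm hintegrable).symm
      _ = (∫ x, f x * γ x ∂μ) * χ t := by
          simp only [map_smul, map_mul, smul_eq_mul, hγ, ← mul_assoc, integral_mul_const]
  exact ⟨γ, fun h => hχt (by rw [hχ_mul_self, h, zero_mul])⟩

theorem isMulCommutative_adjoin_insert_range {G A : Type*} [CommGroup G] [CStarAlgebra A]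
    (u : G →* A) (hstar : ∀ x, star (u x) = u x⁻¹) {t : A} (hcomm : ∀ x, Commute (u x) t)
    (hnormal : IsStarNormal t) :
    IsMulCommutative (StarAlgebra.adjoin ℂ (insert t (Set.range u))) := by
  have hu_comm (x y : G) : Commute (u x) (u y) := (Commute.all x y).map u
  have ht_star_comm (x : G) : Commute (u x) (star t) := by
    have h := (hcomm x⁻¹).star_star
    rwa [hstar, inv_inv] at h
  refine StarAlgebra.isMulCommutative_adjoin ℂ ?_ ?_
  · rintro _ (rfl | ⟨x, rfl⟩) _ (rfl | ⟨y, rfl⟩)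
    · rfl
    · exact (hcomm y).symm
    · exact hcomm x
    · exact hu_comm x y
  · rintro _ (rfl | ⟨x, rfl⟩) _ (rfl | ⟨y, rfl⟩)
    · exact hnormal.star_comm_self.symm
    · rw [hstar]
      exact (hcomm y⁻¹).symm
    · exact ht_star_comm x
    · rw [hstar]
      exact hu_comm x y⁻¹

theorem exists_integral_mul_char_ne_zero_of_isStarNormal {G A : Type*} [CommGroup G]
    [TopologicalSpace G] [MeasurableSpace G] {μ : Measure G} [CStarAlgebra A] (u : G →* A)
    (hstar : ∀ x, star (u x) = u x⁻¹) {t : A} (ht : t ≠ 0) (hcomm : ∀ x, Commute (u x) t)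
    (hnormal : IsStarNormal t) (hcont : Continuous fun x => u x * t) {f : G → ℂ}
    (hf : t * t = ∫ x, f x • (u x * t) ∂μ) :
    ∃ γ : PontryaginDual G, ∫ x, f x * γ x ∂μ ≠ 0 := by
  let S₀ : StarSubalgebra ℂ A := StarAlgebra.adjoin ℂ (insert t (Set.range u))
  let S : StarSubalgebra ℂ A := S₀.topologicalClosure
  have hS : IsClosed (S : Set A) := S₀.isClosed_topologicalClosure
  have hcomm_S₀ : IsMulCommutative S₀ :=
    isMulCommutative_adjoin_insert_range u hstar hcomm hnormal
  let : CommCStarAlgebra S :=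
    { StarSubalgebra.cstarAlgebra S,
      S₀.commRingTopologicalClosure fun x y => hcomm_S₀.is_comm.comm x y with }
  have hmem : insert t (Set.range u) ⊆ S := fun a ha =>
    S₀.le_topologicalClosure (StarAlgebra.subset_adjoin ℂ _ ha)
  let tS : S := ⟨t, hmem (.inl rfl)⟩
  let v : G →* S := u.codRestrict S fun x => hmem (.inr ⟨x, rfl⟩)
  let ι : S →ₗᵢ[ℂ] A := { S.subtype.toLinearMap with norm_map' := fun _ => rfl }
  have htS : tS * tS = ∫ x, f x • (v x * tS) ∂μ :=
    Subtype.ext (hf.trans (ι.integral_comp_comm fun x => f x • (v x * tS)))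
  exact exists_integral_mul_char_ne_zero_of_commute v (fun x => Subtype.ext (hstar x))
    (fun h => ht (congrArg Subtype.val h)) (hcont.subtype_mk _) htS

/-! ### Isometric representations -/

/-- A *strongly continuous isometric representation* of a topological group on a normed space. -/
structure IsIsometricRep {G E : Type*} [Group G] [TopologicalSpace G] [NormedAddCommGroup E]
    [NormedSpace ℂ E] (u : G →* (E →L[ℂ] E)) : Prop where
  norm_apply (x : G) (v : E) : ‖u x v‖ = ‖v‖
  continuous_apply (v : E) : Continuous fun x => u x v

section Translation

variable {G : Type*} [CommGroup G] [TopologicalSpace G] [IsTopologicalGroup G]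
  [MeasurableSpace G] [BorelSpace G]

/-- The translation representation on `Lᵖ(G)`, given by `f ↦ f (x * ·)`; it is multiplicative
because `G` is abelian. -/
noncomputable def translationLp (p : ENNReal) [Fact (1 ≤ p)] (m : Measure G)
    [m.IsMulLeftInvariant] : G →* (Lp ℂ p m →L[ℂ] Lp ℂ p m) where
  toFun x :=
    (Lp.compMeasurePreservingₗᵢ ℂ (x • ·) (measurePreserving_smul x m)).toContinuousLinearMap
  map_one' := by
    ext1 f
    exact one_smul Gᵈᵐᵃ f
  map_mul' x y := by
    ext1 f
    rw [mul_comm x y]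
    exact mul_smul (DomMulAct.mk x) (DomMulAct.mk y) f

variable {p : ENNReal} [Fact (1 ≤ p)] {m : Measure G}

theorem coeFn_translationLp [m.IsMulLeftInvariant] (x : G) (f : Lp ℂ p m) :
    translationLp p m x f =ᵐ[m] fun y => f (x * y) :=
  Lp.coeFn_compMeasurePreserving f (measurePreserving_smul x m)

theorem translationLp_toLp [CompactSpace G] [IsFiniteMeasure m] [m.IsMulLeftInvariant] (x : G)
    (φ : C(G, ℂ)) :
    translationLp p m x (ContinuousMap.toLp p m ℂ φ) =
      ContinuousMap.toLp p m ℂ (φ.comp (ContinuousMap.mulLeft x)) := by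
  refine Lp.ext ((coeFn_translationLp x _).trans ?_)
  exact ((measurePreserving_mul_left m x).quasiMeasurePreserving.ae_eq_comp
    (ContinuousMap.coeFn_toLp m φ)).trans
    (ContinuousMap.coeFn_toLp m (φ.comp (ContinuousMap.mulLeft x))).symm

theorem isIsometricRep_translationLp [Fact (p ≠ ⊤)] [IsLocallyFiniteMeasure m]
    [m.InnerRegularCompactLTTop] [m.IsMulLeftInvariant] : IsIsometricRep (translationLp p m) where
  norm_apply _ f := LinearIsometry.norm_map _ f
  continuous_apply f :=
    (DomMulAct.continuous_mk (M := G)).smul (continuous_const (y := f))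

end Translation

theorem integrable_smul_of_continuous {X E : Type*} [TopologicalSpace X] [CompactSpace X]
    [MeasurableSpace X] [OpensMeasurableSpace X] [NormedAddCommGroup E] [NormedSpace ℂ E]
    {m : Measure X} {f : X → ℂ} (hf : Integrable f m) {w : X → E} (hw : Continuous w) :
    Integrable (fun x => f x • w x) m := by
  obtain ⟨C, hC⟩ := isCompact_univ.exists_bound_of_continuousOn hw.continuousOn
  exact hf.smul_bdd C hw.aestronglyMeasurable_of_compactSpace
    (.of_forall fun x => hC x (Set.mem_univ x))

section IntegratedRep

variable {G E : Type*} [CommGroup G] [TopologicalSpace G] [CompactSpace G]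
  [MeasurableSpace G] [BorelSpace G] [NormedAddCommGroup E] [NormedSpace ℂ E]
  {m : Measure G} {u : G →* (E →L[ℂ] E)}

theorem IsIsometricRep.integrable_smul_apply (hu : IsIsometricRep u) (f : Lp ℂ 1 m) (v : E) :
    Integrable (fun x => f x • u x v) m :=
  integrable_smul_of_continuous (L1.integrable_coeFn f) (hu.continuous_apply v)

/-- The integrated form `f ↦ ∫ f x • u x ∂m` of an isometric representation `u`; the integral
converges only strongly. -/
noncomputable def integratedRep (m : Measure G) (hu : IsIsometricRep u) :
    Lp ℂ 1 m →L[ℂ] E →L[ℂ] E :=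
  LinearMap.mkContinuous₂
    (LinearMap.mk₂ ℂ (fun f v => ∫ x, f x • u x v ∂m)
      (fun f g v => by
        rw [← integral_add (hu.integrable_smul_apply f v) (hu.integrable_smul_apply g v)]
        refine integral_congr_ae ?_
        filter_upwards [Lp.coeFn_add f g] with x hx
        rw [hx, Pi.add_apply, add_smul])
      (fun c f v => by
        rw [← integral_smul]
        refine integral_congr_ae ?_
        filter_upwards [Lp.coeFn_smul c f] with x hx
        rw [hx, Pi.smul_apply, smul_assoc])
      (fun f v w => by
        simp only [map_add, smul_add]
        exact integral_add (hu.integrable_smul_apply f v) (hu.integrable_smul_apply f w))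
      (fun c f v => by
        simp only [map_smul, smul_comm _ c, integral_smul]))
    1 fun f v => by
      rw [LinearMap.mk₂_apply, one_mul, L1.norm_eq_integral_norm, ← integral_mul_const]
      refine (norm_integral_le_integral_norm _).trans_eq ?_
      simp only [norm_smul, hu.norm_apply]

variable (hu : IsIsometricRep u)

theorem integratedRep_apply (f : Lp ℂ 1 m) (v : E) :
    integratedRep m hu f v = ∫ x, f x • u x v ∂m :=
  rfl

theorem commute_integratedRep [CompleteSpace E] {b : E →L[ℂ] E}
    (hb : ∀ x, Commute b (u x)) (f : Lp ℂ 1 m) : Commute b (integratedRep m hu f) := by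
  ext v
  calc b (integratedRep m hu f v) = ∫ x, b (f x • u x v) ∂m :=
        (b.integral_comp_comm (hu.integrable_smul_apply f v)).symm
    _ = ∫ x, f x • u x (b v) ∂m := by
        congr with x
        rw [map_smul]
        exact congrArg (f x • ·) (DFunLike.congr_fun (hb x) v)

theorem mul_integratedRep [IsTopologicalGroup G] [m.IsMulLeftInvariant] [CompleteSpace E] (a : G)
    (f : Lp ℂ 1 m) :
    u a * integratedRep m hu f = integratedRep m hu (translationLp 1 m a⁻¹ f) := by
  ext v
  calc u a (integratedRep m hu f v) = ∫ x, u a (f x • u x v) ∂m :=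
        ((u a).integral_comp_comm (hu.integrable_smul_apply f v)).symm
    _ = ∫ x, f (a⁻¹ * (a * x)) • u (a * x) v ∂m := by
        simp only [map_smul, map_mul, inv_mul_cancel_left]
        rfl
    _ = ∫ x, f (a⁻¹ * x) • u x v ∂m :=
        integral_mul_left_eq_self (fun x => f (a⁻¹ * x) • u x v) a
    _ = ∫ x, translationLp 1 m a⁻¹ f x • u x v ∂m := by
        refine integral_congr_ae ?_
        filter_upwards [coeFn_translationLp a⁻¹ f] with x hx
        rw [hx]

theorem continuous_mul_integratedRep [IsTopologicalGroup G] [m.IsMulLeftInvariant]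
    [IsFiniteMeasure m] [m.InnerRegularCompactLTTop] [CompleteSpace E] (f : Lp ℂ 1 m) :
    Continuous fun x => u x * integratedRep m hu f := by
  simp only [mul_integratedRep hu]
  have : Fact ((1 : ENNReal) ≠ ⊤) := ⟨ENNReal.one_ne_top⟩
  exact (integratedRep m hu).continuous.comp
    ((isIsometricRep_translationLp.continuous_apply f).comp continuous_inv)

theorem integratedRep_mul_self [IsTopologicalGroup G] [m.IsMulLeftInvariant]
    [IsFiniteMeasure m] [m.InnerRegularCompactLTTop] [CompleteSpace E] (f : Lp ℂ 1 m) :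
    integratedRep m hu f * integratedRep m hu f =
      ∫ x, f x • (u x * integratedRep m hu f) ∂m := by
  ext v
  rw [ContinuousLinearMap.integral_apply
    (integrable_smul_of_continuous (L1.integrable_coeFn f) (continuous_mul_integratedRep hu f))]
  rfl

end IntegratedRep

theorem IsIsometricRep.star_apply {G H : Type*} [Group G] [TopologicalSpace G]
    [NormedAddCommGroup H] [InnerProductSpace ℂ H] [CompleteSpace H]
    {u : G →* (H →L[ℂ] H)} (hu : IsIsometricRep u) (x : G) : star (u x) = u x⁻¹ := by
  have h : star (u x) * u x = 1 :=
    (ContinuousLinearMap.norm_map_iff_adjoint_comp_self _).1 (hu.norm_apply x)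
  calc star (u x) = star (u x) * (u x * u x⁻¹) := by
        rw [← map_mul, mul_inv_cancel, map_one, mul_one]
    _ = u x⁻¹ := by rw [← mul_assoc, h, one_mul]

theorem exists_integral_mul_char_ne_zero {G H : Type*} [CommGroup G] [TopologicalSpace G]
    [IsTopologicalGroup G] [CompactSpace G] [MeasurableSpace G] [BorelSpace G]
    [NormedAddCommGroup H] [InnerProductSpace ℂ H] [CompleteSpace H] {m : Measure G}
    [IsFiniteMeasure m] [m.IsMulLeftInvariant] [m.InnerRegularCompactLTTop]
    {u : G →* (H →L[ℂ] H)} (hu : IsIsometricRep u) {f : Lp ℂ 1 m}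
    (hf : integratedRep m hu f ≠ 0) : ∃ γ : PontryaginDual G, ∫ x, f x * γ x ∂m ≠ 0 := by
  have hcomm (x : G) : Commute (u x) (integratedRep m hu f) :=
    commute_integratedRep hu (fun y => (Commute.all x y).map u) f
  have hstar_comm (x : G) : Commute (star (integratedRep m hu f)) (u x) := by
    have h := (hcomm x⁻¹).star_star.symm
    rwa [hu.star_apply, inv_inv] at h
  exact exists_integral_mul_char_ne_zero_of_isStarNormal u hu.star_apply hf hcomm
    ⟨commute_integratedRep hu hstar_comm f⟩ (continuous_mul_integratedRep hu f)
    (integratedRep_mul_self hu f)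

/-! ### Uniqueness of Fourier transforms -/

open scoped BoundedContinuousFunction

theorem ae_eq_zero_of_forall_integral_smul_eq_zero {X E : Type*} [TopologicalSpace X]
    [NormalSpace X] [MeasurableSpace X] [BorelSpace X] [NormedAddCommGroup E] [NormedSpace ℝ E]
    [CompleteSpace E] {m : Measure X} [IsFiniteMeasure m] [m.OuterRegular] {f : X → E}
    (hf : Integrable f m) (h : ∀ φ : X →ᵇ ℝ, ∫ x, φ x • f x ∂m = 0) : f =ᵐ[m] 0 := by
  refine ae_eq_zero_of_forall_setIntegral_isClosed_eq_zero hf fun K hK => ?_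
  rw [← enorm_eq_zero]
  by_contra hne
  obtain ⟨δ, hδ, hδ_int⟩ := exists_pos_setLIntegral_lt_of_measure_lt hf.2.ne hne
  obtain ⟨V, hKV, hV, -, hVK⟩ :=
    hK.measurableSet.exists_isOpen_sdiff_lt (measure_ne_top m K) hδ.ne'
  obtain ⟨φ, hφV, hφK, hφ⟩ := exists_bounded_zero_one_of_closed hV.isClosed_compl hK
    (Set.disjoint_compl_left_iff_subset.2 hKV)
  have hφf : Integrable (fun x => φ x • f x) m :=
    hf.bdd_smul ‖φ‖ φ.continuous.aestronglyMeasurable (.of_forall φ.norm_coe_le_norm)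
  have hsplit : ∫ x in K, f x ∂m = -∫ x in Kᶜ, φ x • f x ∂m := by
    rw [eq_neg_iff_add_eq_zero, ← h φ, ← integral_add_compl hK.measurableSet hφf]
    congr 1
    refine setIntegral_congr_fun hK.measurableSet fun x hx => ?_
    simp only [hφK hx, Pi.one_apply, one_smul]
  have hbound (x : X) : ‖φ x • f x‖ₑ ≤ V.indicator (fun x => ‖f x‖ₑ) x := by
    by_cases hx : x ∈ V
    · rw [Set.indicator_of_mem hx, enorm_smul]
      exact mul_le_of_le_one_left' (by simpa [Real.enorm_of_nonneg (hφ x).1] using (hφ x).2)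
    · simp only [hφV hx, Pi.zero_apply, zero_smul, enorm_zero, zero_le]
  refine (hδ_int _ hVK).not_ge ?_
  calc ‖∫ x in K, f x ∂m‖ₑ = ‖∫ x in Kᶜ, φ x • f x ∂m‖ₑ := by rw [hsplit, enorm_neg]
    _ ≤ ∫⁻ x in Kᶜ, ‖φ x • f x‖ₑ ∂m := enorm_integral_le_lintegral_enorm _
    _ ≤ ∫⁻ x in Kᶜ, V.indicator (fun x => ‖f x‖ₑ) x ∂m := lintegral_mono hbound
    _ = ∫⁻ x in V \ K, ‖f x‖ₑ ∂m := setLIntegral_indicator hV.measurableSet _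

section Uniqueness

variable {G : Type*} [CommGroup G] [TopologicalSpace G] [IsTopologicalGroup G] [CompactSpace G]
  [MeasurableSpace G] [BorelSpace G] {m : Measure G}

/-- The convolution is evaluated at `1` after it has been recognised as a continuous function, the
integral of the translates of `φ` in `C(G)`. -/
theorem integral_mul_eq_zero_of_integratedRep_eq_zero [m.IsHaarMeasure]
    (hu : IsIsometricRep (translationLp 2 m)) {f : Lp ℂ 1 m} (hf : integratedRep m hu f = 0)
    (φ : C(G, ℂ)) : ∫ x, f x * φ x ∂m = 0 := by
  let w : C(G, C(G, ℂ)) := ContinuousMap.curry ⟨fun p : G × G => φ (p.1 * p.2), by fun_prop⟩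
  have hw : Integrable (fun x => f x • w x) m :=
    integrable_smul_of_continuous (L1.integrable_coeFn f) w.continuous
  have htoLp : ContinuousMap.toLp 2 m ℂ (∫ x, f x • w x ∂m) = 0 := by
    calc ContinuousMap.toLp 2 m ℂ (∫ x, f x • w x ∂m)
        = ∫ x, ContinuousMap.toLp 2 m ℂ (f x • w x) ∂m :=
          (ContinuousLinearMap.integral_comp_comm _ hw).symm
      _ = integratedRep m hu f (ContinuousMap.toLp 2 m ℂ φ) := by
          simp only [map_smul, integratedRep_apply, translationLp_toLp]
          rfl
      _ = 0 := by rw [hf, zero_apply]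
  have hzero : ∫ x, f x • w x ∂m = 0 :=
    ContinuousMap.toLp_injective m (htoLp.trans (map_zero _).symm)
  calc ∫ x, f x * φ x ∂m = ∫ x, (f x • w x) 1 ∂m := by
        congr with x
        exact congrArg (f x * φ ·) (mul_one x).symm
    _ = (∫ x, f x • w x ∂m) 1 := ((ContinuousMap.evalCLM ℂ (1 : G)).integral_comp_comm hw)
    _ = 0 := by rw [hzero, ContinuousMap.zero_apply]

theorem eq_zero_of_fourierL1_eq_zero [m.IsHaarMeasure] [m.InnerRegularCompactLTTop]
    {f : Lp ℂ 1 m} (hf : ∀ γ, fourierL1 f γ = 0) : f = 0 := by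
  have : Fact ((2 : ENNReal) ≠ ⊤) := ⟨ENNReal.ofNat_ne_top⟩
  have hu : IsIsometricRep (translationLp 2 m) := isIsometricRep_translationLp
  have hconv : integratedRep m hu f = 0 := by
    by_contra hne
    obtain ⟨γ, hγ⟩ := exists_integral_mul_char_ne_zero hu hne
    refine hγ (.trans ?_ (hf γ⁻¹))
    congr with x
    change f x * (γ x : ℂ) = conj (((γ x)⁻¹ : Circle) : ℂ) * f x
    rw [Circle.coe_inv_eq_conj, Complex.conj_conj, mul_comm]
  refine Lp.ext ((ae_eq_zero_of_forall_integral_smul_eq_zero (L1.integrable_coeFn f)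
    fun φ => ?_).trans (Lp.coeFn_zero ℂ 1 m).symm)
  rw [← integral_mul_eq_zero_of_integratedRep_eq_zero hu hconv ⟨fun x => (φ x : ℂ), by fun_prop⟩]
  congr with x
  exact Complex.real_smul.trans (mul_comm _ _)

end Uniqueness

/-! ### Integration of vector-valued functions against complex measures -/

section ComplexIntegral

variable {X E F : Type*} [MeasurableSpace X] [NormedAddCommGroup E] [NormedSpace ℂ E]
  [NormedAddCommGroup F] [NormedSpace ℂ F] (μ : ComplexMeasure X)

/-- The integral of a vector-valued function against a complex measure. -/
noncomputable def complexIntegral (f : X → E) : E :=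
  VectorMeasure.integral μ f (ContinuousLinearMap.lsmul ℝ ℂ).flip

theorem fourierStieltjes_eq_complexIntegral {G : Type*} [CommGroup G] [TopologicalSpace G]
    [MeasurableSpace G] (μ : ComplexMeasure G) (γ : PontryaginDual G) :
    fourierStieltjes μ γ = complexIntegral μ fun x => conj (γ x : ℂ) := by
  have h : ContinuousLinearMap.mul ℝ ℂ = (ContinuousLinearMap.lsmul ℝ ℂ).flip := by
    ext a c
    exact mul_comm a c
  rw [fourierStieltjes, complexIntegral, h]

variable {μ}

theorem map_complexIntegral [CompleteSpace E] [CompleteSpace F] (L : E →L[ℂ] F) {f : X → E}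
    (hf : Integrable f μ.variation) :
    L (complexIntegral μ f) = complexIntegral μ fun x => L (f x) := by
  let L' : E →L[ℝ] F := L.restrictScalars ℝ
  refine (VectorMeasure.continuousLinearMap_apply_integral (C := L') hf).trans
    (.trans ?_ (VectorMeasure.integral_continuousLinearMap_comp (C := L') hf).symm)
  congr 1
  ext v c
  exact map_smul L c v

theorem norm_singleton_mul_norm_le [MeasurableSingletonClass X] [CompleteSpace E]
    [IsFiniteMeasure μ.variation] {f : X → E} (hf : Integrable f μ.variation)
    (hzero : complexIntegral μ f = 0) {b : X} {W : Set X} (hW : MeasurableSet W) (hb : b ∈ W)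
    {C₁ C₂ : ℝ} (hC₁ : ∀ x ∈ W \ {b}, ‖f x‖ ≤ C₁) (hC₂ : ∀ x ∈ Wᶜ, ‖f x‖ ≤ C₂) :
    ‖μ {b}‖ * ‖f b‖ ≤ C₁ * μ.variation.real (W \ {b}) + C₂ * μ.variation.real Wᶜ := by
  set B : E →L[ℝ] ℂ →L[ℝ] E := (ContinuousLinearMap.lsmul ℝ ℂ).flip with hB
  have hB_norm : ‖B‖ ≤ 1 := by
    rw [hB, ContinuousLinearMap.opNorm_flip]
    exact ContinuousLinearMap.opNorm_lsmul_le
  have hbound {C : ℝ} {s : Set X} (hC : ∀ x ∈ s, ‖f x‖ ≤ C) :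
      ‖∫ᵛ x in s, f x ∂[B; μ]‖ ≤ C * μ.variation.real s := by
    rcases s.eq_empty_or_nonempty with rfl | ⟨x, hx⟩
    · simp
    · refine (VectorMeasure.norm_setIntegral_le_of_norm_le_const hC).trans ?_
      gcongr
      exact mul_le_of_le_one_right ((norm_nonneg _).trans (hC x hx)) hB_norm
  have hsplit : μ {b} • f b = -(∫ᵛ x in W \ {b}, f x ∂[B; μ] + ∫ᵛ x in Wᶜ, f x ∂[B; μ]) := by
    have hWf := VectorMeasure.setIntegral_add_compl (B := B) hW hf
    have hbf := VectorMeasure.setIntegral_sdiff (B := B) hW (measurableSet_singleton b)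
      (VectorMeasure.Integrable.integrableOn hf) (Set.singleton_subset_iff.2 hb)
    rw [VectorMeasure.integral_singleton] at hbf
    change _ = complexIntegral μ f at hWf
    rw [hbf, sub_add_eq_add_sub, hWf, hzero, zero_sub, neg_neg]
    rfl
  calc ‖μ {b}‖ * ‖f b‖ = ‖∫ᵛ x in W \ {b}, f x ∂[B; μ] + ∫ᵛ x in Wᶜ, f x ∂[B; μ]‖ := by
        rw [← norm_smul, hsplit, norm_neg]
    _ ≤ C₁ * μ.variation.real (W \ {b}) + C₂ * μ.variation.real Wᶜ :=
        norm_add_le_of_le (hbound hC₁) (hbound hC₂)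

end ComplexIntegral

section Translation

variable {G : Type*} [CommGroup G] [TopologicalSpace G] [IsTopologicalGroup G]
  [MeasurableSpace G] [BorelSpace G] {m : Measure G}

theorem fourierL1_translationLp [m.IsMulLeftInvariant] (y : G) (f : Lp ℂ 1 m)
    (γ : PontryaginDual G) : fourierL1 (translationLp 1 m y f) γ = γ y * fourierL1 f γ := by
  have hchar (x : G) : conj (γ x : ℂ) = γ y * conj (γ (y * x) : ℂ) := by
    rw [map_mul, Circle.coe_mul, map_mul, ← mul_assoc, Complex.mul_conj', Circle.norm_coe,
      Complex.ofReal_one, one_pow, one_mul]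
  calc ∫ x, conj (γ x : ℂ) * translationLp 1 m y f x ∂m
      = ∫ x, γ y * (conj (γ (y * x) : ℂ) * f (y * x)) ∂m := by
        refine integral_congr_ae ?_
        filter_upwards [coeFn_translationLp y f] with x hx
        rw [hx, hchar, mul_assoc]
    _ = γ y * ∫ x, conj (γ (y * x) : ℂ) * f (y * x) ∂m := integral_const_mul _ _
    _ = γ y * fourierL1 f γ := by
        rw [integral_mul_left_eq_self (fun x => conj (γ x : ℂ) * f x) y, fourierL1]

theorem norm_restrict_translationLp [m.IsMulLeftInvariant] (s : Set G) (y : G) (f : Lp ℂ 1 m) :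
    ‖LpToLpRestrictCLM G ℂ ℂ m 1 s (translationLp 1 m y f)‖ = ∫ x in y • s, ‖f x‖ ∂m := by
  rw [L1.norm_eq_integral_norm]
  calc ∫ x in s, ‖LpToLpRestrictCLM G ℂ ℂ m 1 s (translationLp 1 m y f) x‖ ∂m
      = ∫ x in s, ‖f (y * x)‖ ∂m := by
        refine integral_congr_ae ?_
        filter_upwards [LpToLpRestrictCLM_coeFn ℂ s (translationLp 1 m y f),
          ae_restrict_of_ae (coeFn_translationLp y f)] with x hx hx'
        rw [hx, hx']
    _ = ∫ x in y • s, ‖f x‖ ∂m :=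
        ((measurePreserving_mul_left m y).setIntegral_image_emb
          (Homeomorph.mulLeft y).measurableEmbedding (fun x => ‖f x‖) s).symm

variable [CompactSpace G] [m.InnerRegularCompactLTTop]

theorem integrable_translationLp [IsLocallyFiniteMeasure m] [m.IsMulLeftInvariant]
    (μ : Measure G) [IsFiniteMeasure μ] (f : Lp ℂ 1 m) :
    Integrable (fun y => translationLp 1 m y f) μ := by
  have : Fact ((1 : ENNReal) ≠ ⊤) := ⟨ENNReal.one_ne_top⟩
  have hτ : IsIsometricRep (translationLp 1 m) := isIsometricRep_translationLp
  exact .of_bound (hτ.continuous_apply f).aestronglyMeasurable_of_compactSpace ‖f‖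
    (.of_forall fun y => (hτ.norm_apply y f).le)

theorem fourierL1_complexIntegral_translationLp [IsLocallyFiniteMeasure m] [m.IsMulLeftInvariant]
    (μ : ComplexMeasure G) [IsFiniteMeasure μ.variation] (f : Lp ℂ 1 m) (γ : PontryaginDual G) :
    fourierL1 (complexIntegral μ fun y => translationLp 1 m y f) γ =
      fourierL1 f γ * fourierStieltjes μ γ⁻¹ := by
  have hchar : Integrable (fun y => (γ y : ℂ)) μ.variation :=
    .of_bound (by have := map_continuous γ; fun_prop) 1
      (.of_forall fun y => (Circle.norm_coe (γ y)).le)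
  have hconj (y : G) : conj ((γ⁻¹ y : Circle) : ℂ) = γ y := by
    change conj (((γ y)⁻¹ : Circle) : ℂ) = γ y
    rw [Circle.coe_inv_eq_conj, Complex.conj_conj]
  calc fourierL1CLM m γ (complexIntegral μ fun y => translationLp 1 m y f)
      = complexIntegral μ fun y => fourierL1 (translationLp 1 m y f) γ :=
        map_complexIntegral _ (integrable_translationLp _ f)
    _ = complexIntegral μ fun y => fourierL1 f γ * γ y := by
        simp only [fourierL1_translationLp, mul_comm]
    _ = fourierL1 f γ * complexIntegral μ fun y => (γ y : ℂ) :=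
        (map_complexIntegral (ContinuousLinearMap.mul ℂ ℂ (fourierL1 f γ)) hchar).symm
    _ = fourierL1 f γ * fourierStieltjes μ γ⁻¹ := by
        simp only [fourierStieltjes_eq_complexIntegral, hconj]

theorem complexIntegral_translationLp_eq_zero [m.IsHaarMeasure] {μ : ComplexMeasure G}
    [IsFiniteMeasure μ.variation] {Λ : Set (PontryaginDual G)} (hμ : specMeasure μ ⊆ Λ)
    {f : Lp ℂ 1 m} (hf : specL1 f ⊆ (Λ⁻¹)ᶜ) :
    complexIntegral μ (fun y => translationLp 1 m y f) = 0 := by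
  refine eq_zero_of_fourierL1_eq_zero fun γ => ?_
  rw [fourierL1_complexIntegral_translationLp]
  by_cases hγ : γ ∈ Λ⁻¹
  · rw [by_contra fun h => hf h hγ, zero_mul]
  · rw [by_contra fun h => hγ (hμ h), mul_zero]

theorem norm_singleton_mul_setIntegral_norm_le [T1Space G] [IsLocallyFiniteMeasure m]
    [m.IsMulLeftInvariant] {μ : ComplexMeasure G} [IsFiniteMeasure μ.variation] {f : Lp ℂ 1 m}
    (hzero : complexIntegral μ (fun y => translationLp 1 m y f) = 0) {K W : Set G}
    {b : G} (hW : MeasurableSet W) (hb : b ∈ W) (hKW : b • (K / K) ⊆ W) :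
    ‖μ {b}‖ * ∫ x in K, ‖f x‖ ∂m ≤
      ‖f‖ * μ.variation.real (W \ {b}) + (∫ x in Kᶜ, ‖f x‖ ∂m) * μ.variation.real Wᶜ := by
  let P := LpToLpRestrictCLM G ℂ ℂ m 1 (b⁻¹ • K)
  have hf : Integrable (fun x => ‖f x‖) m := (L1.integrable_coeFn f).norm
  have hτ := integrable_translationLp μ.variation f
  have hP (y : G) : ‖P (translationLp 1 m y f)‖ = ∫ x in y • b⁻¹ • K, ‖f x‖ ∂m :=
    norm_restrict_translationLp _ y f
  have hPb : ‖P (translationLp 1 m b f)‖ = ∫ x in K, ‖f x‖ ∂m := by rw [hP, smul_inv_smul]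
  have hdisj {y : G} (hy : y ∉ W) : y • b⁻¹ • K ⊆ Kᶜ := by
    rintro _ ⟨_, ⟨x, hx, rfl⟩, rfl⟩ hxK
    refine hy (hKW ⟨_, Set.div_mem_div hxK hx, ?_⟩)
    simp only [smul_eq_mul]
    rw [← mul_assoc y, mul_div_cancel_right, mul_left_comm, mul_inv_cancel, mul_one]
  rw [← hPb]
  refine norm_singleton_mul_norm_le (P.integrable_comp hτ) ?_ hW hb (fun y _ => ?_) fun y hy => ?_
  · rw [← map_complexIntegral P hτ, hzero, map_zero]
  · rw [hP, L1.norm_eq_integral_norm]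
    exact setIntegral_le_integral hf (.of_forall fun x => norm_nonneg _)
  · rw [hP]
    exact setIntegral_mono_set hf.integrableOn (.of_forall fun x => norm_nonneg _)
      (hdisj hy).eventuallyLE

end Translation

/-! ### Concentrated functions in rich subspaces -/

section Rich

variable {X : Type*} [MeasurableSpace X] {m : Measure X}

theorem setIntegral_compl_norm_le {E : Type*} [NormedAddCommGroup E] [NormedSpace ℝ E] {f : X → E}
    (hf : Integrable f m) {K : Set X} (hK : MeasurableSet K) :
    ∫ x in Kᶜ, ‖f x‖ ∂m ≤ ∫ x, ‖f x‖ ∂m - ‖∫ x in K, f x ∂m‖ := by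
  rw [← integral_add_compl hK hf.norm]
  linarith [norm_integral_le_integral_norm (μ := m.restrict K) f]

theorem setIntegral_norm_sub_le (f g : Lp ℂ 1 m) (s : Set X) :
    ∫ x in s, ‖(f - g : Lp ℂ 1 m) x‖ ∂m ≤ ∫ x in s, ‖f x‖ ∂m + ‖g‖ := by
  have hf : Integrable (fun x => ‖f x‖) m := (L1.integrable_coeFn f).norm
  have hg : Integrable (fun x => ‖g x‖) m := (L1.integrable_coeFn g).norm
  calc ∫ x in s, ‖(f - g : Lp ℂ 1 m) x‖ ∂m ≤ ∫ x in s, (‖f x‖ + ‖g x‖) ∂m := by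
        refine integral_mono_ae (L1.integrable_coeFn _).norm.restrict (hf.add hg).restrict ?_
        filter_upwards [ae_restrict_of_ae (Lp.coeFn_sub f g)] with x hx
        rw [hx]
        exact norm_sub_le _ _
    _ = ∫ x in s, ‖f x‖ ∂m + ∫ x in s, ‖g x‖ ∂m :=
        integral_add hf.restrict hg.restrict
    _ ≤ ∫ x in s, ‖f x‖ ∂m + ‖g‖ := by
        rw [L1.norm_eq_integral_norm g]
        exact add_le_add_right (setIntegral_le_integral hg (.of_forall fun x => norm_nonneg _)) _

/-- Narrowness is applied to `x = -y`, where `y` is the normalised indicator function of `K`, and to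
the functional `∫ x in K, · ∂m`: as `∫ x in K, z ∂m` is almost `1 = ‖z‖`, the function `z` is almost
supported in `K`, and `y - z` is the required function. -/
theorem IsNarrow.exists_concentrated {E : Type*} [NormedAddCommGroup E] [NormedSpace ℂ E]
    {T : Lp ℂ 1 m →L[ℂ] E} (hT : IsNarrow T) {K : Set X} (hK : MeasurableSet K) (hmK : m K ≠ 0)
    (hmK_top : m K ≠ ⊤) {ε : ℝ} (hε : 0 < ε) :
    ∃ w : Lp ℂ 1 m, ‖T w‖ ≤ ε ∧ 2 - ε ≤ ‖w‖ ∧ ∫ x in Kᶜ, ‖w x‖ ∂m ≤ ε := by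
  have hmK_real : m.real K ≠ 0 := (measureReal_ne_zero_iff hmK_top).2 hmK
  let y : Lp ℂ 1 m := indicatorConstLp 1 hK hmK_top ((m.real K : ℂ)⁻¹)
  have hy : y =ᵐ[m] K.indicator fun _ => (m.real K : ℂ)⁻¹ := indicatorConstLp_coeFn
  have hy_norm : ‖y‖ = 1 := by
    rw [norm_indicatorConstLp one_ne_zero ENNReal.one_ne_top, norm_inv, Complex.norm_real,
      Real.norm_of_nonneg measureReal_nonneg]
    simp [hmK_real]
  let φ : Lp ℂ 1 m →L[ℂ] ℂ := L1.integralCLM' ℂ ∘L LpToLpRestrictCLM X ℂ ℂ m 1 K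
  have hφ (f : Lp ℂ 1 m) : φ f = ∫ x in K, f x ∂m := by
    rw [← integral_congr_ae (LpToLpRestrictCLM_coeFn ℂ K f), ← L1.integral_eq_integral,
      L1.integral_eq' ℂ]
    rfl
  have hφy : φ y = 1 := by
    rw [hφ, integral_congr_ae (ae_restrict_of_ae hy), setIntegral_indicator hK]
    simp [hmK_real]
  obtain ⟨z, hz_norm, hyz, hz_far⟩ := hT (-y) y (by rwa [norm_neg]) hy_norm φ ε hε
  have hφz : ‖1 - φ z‖ ≤ ε := by
    rw [← hφy, ← map_sub]
    exact (le_add_of_nonneg_left (norm_nonneg _)).trans hyz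
  refine ⟨y - z, (le_add_of_nonneg_right (norm_nonneg _)).trans hyz, ?_, ?_⟩
  · rwa [neg_add_eq_sub, norm_sub_rev] at hz_far
  · calc ∫ x in Kᶜ, ‖(y - z : Lp ℂ 1 m) x‖ ∂m = ∫ x in Kᶜ, ‖z x‖ ∂m := by
          refine setIntegral_congr_ae hK.compl ?_
          filter_upwards [Lp.coeFn_sub y z, hy] with x hx hyx hxK
          rw [hx, Pi.sub_apply, hyx, Set.indicator_of_notMem hxK, zero_sub, norm_neg]
      _ ≤ ‖(1 : ℂ)‖ - ‖φ z‖ := by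
          rw [norm_one, ← hz_norm, hφ, L1.norm_eq_integral_norm z]
          exact setIntegral_compl_norm_le (L1.integrable_coeFn z) hK
      _ ≤ ε := (norm_sub_norm_le _ _).trans hφz

theorem IsRich.exists_concentrated {Y : ClosedSubmodule ℂ (Lp ℂ 1 m)} (hY : IsRich Y)
    {K : Set X} (hK : MeasurableSet K) (hmK : m K ≠ 0) (hmK_top : m K ≠ ⊤) {ε : ℝ} (hε : 0 < ε) :
    ∃ f ∈ Y, ‖f‖ = 1 ∧ ∫ x in Kᶜ, ‖f x‖ ∂m ≤ ε := by
  have : IsClosed (Y.toSubmodule : Set (Lp ℂ 1 m)) := Y.isClosed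
  have hδ_pos : 0 < min (ε / 3) (1 / 3) := by positivity
  obtain ⟨w, hwY, hw, hwK⟩ := IsNarrow.exists_concentrated hY hK hmK hmK_top hδ_pos
  obtain ⟨v, hv, hv_norm⟩ := Submodule.Quotient.norm_mk_lt (S := Y.toSubmodule)
    (Y.toSubmodule.mkQ w) hδ_pos
  have hwY : ‖Y.toSubmodule.mkQ w‖ ≤ min (ε / 3) (1 / 3) := hwY
  set δ := min (ε / 3) (1 / 3)
  have hδ_eps : δ ≤ ε / 3 := min_le_left _ _
  have hδ_one : δ ≤ 1 / 3 := min_le_right _ _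
  set g := w - v
  have hg_mem : g ∈ Y := (Submodule.Quotient.eq _).1 hv.symm
  have hg_norm : 1 ≤ ‖g‖ := by linarith [norm_sub_norm_le w v]
  have hgK : ∫ x in Kᶜ, ‖g x‖ ∂m ≤ ε := by linarith [setIntegral_norm_sub_le w v Kᶜ]
  refine ⟨(‖g‖⁻¹ : ℂ) • g, Y.smul_mem _ hg_mem, ?_, ?_⟩
  · rw [norm_smul, norm_inv, Complex.norm_real, norm_norm, inv_mul_cancel₀ (by positivity)]
  · calc ∫ x in Kᶜ, ‖((‖g‖⁻¹ : ℂ) • g : Lp ℂ 1 m) x‖ ∂m = ∫ x in Kᶜ, ‖g‖⁻¹ * ‖g x‖ ∂m := by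
          refine integral_congr_ae ?_
          filter_upwards [ae_restrict_of_ae (Lp.coeFn_smul (‖g‖⁻¹ : ℂ) g)] with x hx
          rw [hx, Pi.smul_apply, norm_smul, norm_inv, Complex.norm_real, norm_norm]
      _ = ‖g‖⁻¹ * ∫ x in Kᶜ, ‖g x‖ ∂m := integral_const_mul _ _
      _ ≤ ∫ x in Kᶜ, ‖g x‖ ∂m :=
          mul_le_of_le_one_left (integral_nonneg fun x => norm_nonneg _)
            (inv_le_one_of_one_le₀ hg_norm)
      _ ≤ ε := hgK

end Rich

/-! ### Atoms -/

theorem isDiffuse_of_forall_singleton_eq_zero {X : Type*} [MeasurableSpace X]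
    [MeasurableSingletonClass X] {μ : ComplexMeasure X} (h : ∀ b, μ {b} = 0) : IsDiffuse μ := by
  intro B hB
  have := hB.to_subtype
  rw [← Set.iUnion_of_singleton_coe B, VectorMeasure.of_disjoint_iUnion
    (fun _ => measurableSet_singleton _)
    fun a b hab => Set.disjoint_singleton.2 (Subtype.coe_injective.ne hab)]
  simp only [h, tsum_zero]

section Atoms

variable {G : Type*} [CommGroup G] [TopologicalSpace G] [IsTopologicalGroup G] [CompactSpace G]
  [T1Space G] [MeasurableSpace G] [BorelSpace G] {m : Measure G} [m.IsHaarMeasure]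
  [m.InnerRegularCompactLTTop] {Λ : Set (PontryaginDual G)} {μ : ComplexMeasure G}

theorem IsRich.norm_singleton_le_variation_sdiff (h : IsRich (L1Spec m (Λ⁻¹)ᶜ))
    (hμ : specMeasure μ ⊆ Λ) [IsFiniteMeasure μ.variation] {b : G} {W : Set G} (hW : IsOpen W)
    (hb : b ∈ W) : ‖μ {b}‖ ≤ μ.variation.real (W \ {b}) := by
  obtain ⟨K, hK_one, hK, hK_inv, hK_sub⟩ := exists_closed_nhds_one_inv_eq_mul_subset
    (U := b⁻¹ • W) ((hW.smul b⁻¹).mem_nhds ⟨b, hb, inv_mul_cancel b⟩)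
  have hKW : b • (K / K) ⊆ W := by
    rw [div_eq_mul_inv, hK_inv]
    exact Set.smul_set_subset_iff_subset_inv_smul_set.2 hK_sub
  set C := ‖μ {b}‖ + μ.variation.real Wᶜ
  refine le_of_forall_pos_le_add fun δ hδ => ?_
  obtain ⟨f, hfY, hf, hfK⟩ := h.exists_concentrated hK.measurableSet
    (Measure.measure_pos_of_mem_nhds m hK_one).ne' (measure_ne_top m K)
    (show 0 < δ / (C + 1) by positivity)
  set ε := ∫ x in Kᶜ, ‖f x‖ ∂m
  have hfK_eq : ∫ x in K, ‖f x‖ ∂m = 1 - ε := by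
    rw [← hf, L1.norm_eq_integral_norm, eq_sub_iff_add_eq]
    exact integral_add_compl hK.measurableSet (L1.integrable_coeFn f).norm
  have hatom := norm_singleton_mul_setIntegral_norm_le
    (complexIntegral_translationLp_eq_zero hμ hfY) hW.measurableSet hb hKW
  have hεC : ε * C ≤ δ := by
    calc ε * C ≤ δ / (C + 1) * (C + 1) := by gcongr; linarith
      _ = δ := div_mul_cancel₀ δ (by positivity)
  rw [hfK_eq, hf] at hatom
  linarith

theorem IsRich.singleton_eq_zero (h : IsRich (L1Spec m (Λ⁻¹)ᶜ)) (hμ : specMeasure μ ⊆ Λ)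
    [IsFiniteMeasure μ.variation] [μ.variation.OuterRegular] (b : G) : μ {b} = 0 := by
  refine norm_le_zero_iff.1 (le_of_forall_pos_le_add fun ε hε => ?_)
  obtain ⟨W, hbW, hW, -, hWε⟩ := (measurableSet_singleton b).exists_isOpen_sdiff_lt
    (measure_ne_top μ.variation {b}) (ENNReal.ofReal_pos.2 hε).ne'
  rw [zero_add]
  exact (h.norm_singleton_le_variation_sdiff hμ hW (Set.singleton_subset_iff.1 hbW)).trans
    (ENNReal.toReal_le_of_le_ofReal hε.le hWε.le)

end Atoms

theorem mainTheorem3 {G : Type*} [CommGroup G] [TopologicalSpace G] [IsTopologicalGroup G]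
    [CompactSpace G] [T2Space G] [Infinite G] [MeasurableSpace G] [BorelSpace G]
    (m : Measure G) [m.IsHaarMeasure] [m.Regular] [IsProbabilityMeasure m]
    (Λ : Set (PontryaginDual G)) (h : IsRich (L1Spec m (Λ⁻¹)ᶜ)) :
    IsSemiRiesz Λ := by
  rintro μ ⟨hμ_regular, hμ⟩
  exact isDiffuse_of_forall_singleton_eq_zero (h.singleton_eq_zero hμ)
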